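/- **Conventions.** A Boolean ring is a ring $R$, not necessarily with identity, in which $a^2=a$ for all $a$. Its Stone space $X$ is the set of nonzero ring homomorphisms $\varphi\colon R\to\mathbb F_2$, with the topology whose base is formed by the sets $\hat a=\{\varphi:\varphi(a)=1\}$, $a\in R$. For closed $C\subseteq X$ put $I(C)=\{a\in R:\hat a\cap C=\emptyset\}$, an ideal of $R$. A closure subalgebra of $2^X$ is a family $\mathscr C$ of subsets of $X$ that contains $\emptyset$ and $X$ and is closed under finite unions, finite intersections, complements and topological closure $A\mapsto\overline A$; it is generated by its closed elements if it is the smallest closure subalgebra of $2^X$ that contains all the closed sets belonging to $\mathscr C$. A point of $A\subseteq X$ is isolated if it is not a limit point of $A$. The system $(R,\{I(\overline C): C\in\mathscr C\})$ is regarded as a first-order structure with the ring operations and one unary predicate for each $C\in\mathscr C$, interpreted as $I(\overline C)$. A countable structure $M$ for a language $L$ is called $\omega$-categorical if either (i) $L$ is countable and every countable $L$-structure that is elementarily equivalent to $M$ is isomorphic to $M$, or (ii) for every $r\ge 0$ the automorphism group of $M$ has only finitely many orbits on $M^r$. (By the Engeler–Ryll-Nardzewski–Svenonius theorem, (i) and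 (ii) are equivalent when $L$ is countable; for uncountable $L$ the notion means (ii).) **Proposition.** Let $R$ be a countable Boolean ring with Stone space $X$, and let $\mathscr C$ be a closure subalgebra of $2^X$, of any cardinality, generated by its closed elements, such that the system $(R,\{I(\overline C): C\in\mathscr C\})$ is $\omega$-categorical. Then $\mathscr C$ is finite, and each atom of the Boolean algebra $\mathscr C$ has only finitely many isolated points. -/

import Mathlib

open scoped FirstOrder

universe u v w

/-! ### Omega-categorical structures -/

/-- The countable structure `M` is determined, up to isomorphism, among the countable
`L`-structures by its complete first-order theory.  (Countable includes finite.) -/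
def DeterminedByTheory (L : FirstOrder.Language.{u, v}) (M : Type w) [L.Structure M] : Prop :=
  ∀ (N : Type w) [L.Structure N], Countable N → L.ElementarilyEquivalent M N →
    Nonempty (M ≃[L] N)

/-- The automorphism group of `M` has only finitely many orbits on `M ^ r`: finitely many
`r`-tuples represent all the orbits. -/
def AlmostTransitive (L : FirstOrder.Language.{u, v}) (M : Type w) [L.Structure M] (r : ℕ) : Prop :=
  ∃ S : Set (Fin r → M), S.Finite ∧
    ∀ x : Fin r → M, ∃ s ∈ S, ∃ g : M ≃[L] M, ∀ i, g (s i) = x i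

/-- Omega-categoricity of a countable structure `M`.  For a countable language it means that `M`
is determined among countable structures by its theory.  For countable languages this is
equivalent, by the Engeler--Ryll-Nardzewski--Svenonius theorem, to the automorphism group having
finitely many orbits on `M ^ r` for all `r`; that equivalence fails for uncountable languages,
where omega-categoricity is understood in the second form. -/
def IsOmegaCategorical (L : FirstOrder.Language.{u, v}) (M : Type w) [L.Structure M] : Prop :=
  (Countable L.Symbols ∧ DeterminedByTheory L M) ∨ ∀ r : ℕ, AlmostTransitive L M r

/-! ### Rings with distinguished subsets as first-order structures -/

/-- Operation symbols `0, +, *` of (not necessarily unital) Boolean rings; there `-a = a`. -/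
inductive BoolRingFunc : ℕ → Type
  | zero : BoolRingFunc 0
  | add : BoolRingFunc 2
  | mul : BoolRingFunc 2

/-- One unary predicate symbol for each `i : ι`, and no other relation symbol. -/
inductive IdealRel (ι : Type u) : ℕ → Type u
  | mem (i : ι) : IdealRel ι 1

/-- The language of Boolean rings with a family of distinguished ideals indexed by `ι`. -/
def idealLanguage (ι : Type u) : FirstOrder.Language.{0, u} where
  Functions := BoolRingFunc
  Relations := IdealRel ι

/-- The system `(R, {J i | i ∈ ι})`. -/
@[reducible] def idealSystem (R : Type w) [NonUnitalRing R] {ι : Type u} (J : ι → Set R) :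
    (idealLanguage ι).Structure R where
  funMap := fun {_} f =>
    match f with
    | BoolRingFunc.zero => fun _ => 0
    | BoolRingFunc.add => fun x => x 0 + x 1
    | BoolRingFunc.mul => fun x => x 0 * x 1
  RelMap := fun {_} P =>
    match P with
    | IdealRel.mem i => fun x => x 0 ∈ J i

/-- The system `(R, {J i | i ∈ ι})` is omega-categorical. -/
def IsOmegaCategoricalSystem (R : Type w) [NonUnitalRing R] {ι : Type u} (J : ι → Set R) : Prop :=
  letI := idealSystem R J
  IsOmegaCategorical (idealLanguage ι) R

/-! ### The Stone space of a Boolean ring, possibly without identity -/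

/-- The points of the Stone space of a Boolean ring `R`: the nonzero ring homomorphisms from `R`
to the two-element field (equivalently, through their kernels, the maximal ideals of `R`). -/
def StoneSpace (R : Type w) [NonUnitalRing R] : Type w :=
  {φ : R →ₙ+* ZMod 2 // φ ≠ 0}

/-- The compact open subset of the Stone space that corresponds to `a : R`. -/
def stoneSet {R : Type w} [NonUnitalRing R] (a : R) : Set (StoneSpace R) :=
  {φ | φ.1 a = 1}

/-- The Stone topology, with the sets `stoneSet a` as a base. -/
instance {R : Type w} [NonUnitalRing R] : TopologicalSpace (StoneSpace R) :=
  TopologicalSpace.generateFrom (Set.range (stoneSet (R := R)))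

/-- The ideal `I(C) = {A ∈ R | A ∩ C = ∅}` of a (closed) subset `C` of the Stone space. -/
def stoneIdeal {R : Type w} [NonUnitalRing R] (C : Set (StoneSpace R)) : Set R :=
  {a | stoneSet a ∩ C = ∅}

/-! ### Closure subalgebras of `2 ^ X` -/

/-- A closure subalgebra of `2 ^ X`: a Boolean subalgebra stable under topological closure. -/
structure ClosureSubalgebra (X : Type w) [TopologicalSpace X] extends
    BooleanSubalgebra (Set X) where
  closure_mem' : ∀ A ∈ carrier, closure A ∈ carrier

/-- `𝒞` is generated, as a closure algebra, by its closed elements: it is contained in every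
closure subalgebra that contains all its closed elements. -/
def ClosureSubalgebra.GeneratedByClosed {X : Type w} [TopologicalSpace X]
    (𝒞 : ClosureSubalgebra X) : Prop :=
  ∀ 𝒟 : ClosureSubalgebra X,
    (∀ C ∈ 𝒞.toBooleanSubalgebra, IsClosed C → C ∈ 𝒟.toBooleanSubalgebra) →
      𝒞.toBooleanSubalgebra ≤ 𝒟.toBooleanSubalgebra

/-- The set of isolated points of a subset `A` of a topological space: the points of `A` that
are not limit points of `A`. -/
def isolatedPoints {X : Type w} [TopologicalSpace X] (A : Set X) : Set X :=
  A \ derivedSet A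

/-!
The argument has a model-theoretic half and a topological half.

The first half derives from omega-categoricity of a structure `M` that only finitely many complete
types without parameters are realized in `Mʳ`; this is all that is used of it. If the automorphism group has
finitely many orbits, that is immediate. Otherwise the language is countable and `M` is the only
countable model of its theory, and the needed direction of the Ryll-Nardzewski theorem is proved
inside `M`. Compactness and the downward Löwenheim--Skolem theorem make `M` saturated over the empty
set in countably many variables (`DeterminedByTheory.sInter_nonempty`). A tuple `m` of nonisolated
type cannot exist: genericity with respect to a countable family of cofinal sets of definable
conditions yields a sequence in `M` whose range is an elementary substructure omitting the type
of `m`, yet that substructure is countable, hence isomorphic to `M`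
(`DeterminedByTheory.not_nonisolated`). Saturation then gives a finite cover of `Mʳ` by definable
sets all of whose elements have the same type (`DeterminedByTheory.finitelyManyTypes`).

The second half uses only types of single elements. The ideals `I(C)` with `C ∈ 𝒞` closed are
definable, so there are finitely many of them, and a closed set is recovered from its ideal; hence
`𝒞` has finitely many closed members (`finite_closed_mem`). The members of `𝒞` that are unions of
cells of the finite partition induced by these closed sets form a closure subalgebra, since closures
of members of `𝒞` are again among these closed sets. As `𝒞` is generated by its closed elements,
every member of `𝒞` is such a union, and `𝒞` is finite (`finite_of_finite_closed_mem`). Finally, if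
`A ∈ 𝒞` had infinitely many isolated points, then for each `n` some basic compact open set would
meet the closure of `A` in exactly `n` points. The statement that it meets it in at least `n` points
is first-order, so infinitely many types would be realized (`finite_isolatedPoints`).
-/

section OmegaCategoricity

open FirstOrder FirstOrder.Language Set

variable {L : FirstOrder.Language.{u, v}} {M : Type w} [L.Structure M]

/-! ### Saturation of a structure determined by its theory -/

/-- The universe of the countable model does not matter, since a countable type has a copy in
every universe. -/
theorem DeterminedByTheory.nonempty_equiv (h : DeterminedByTheory L M) {N : Type*}
    [L.Structure N] [Countable N] (hN : M ≅[L] N) : Nonempty (M ≃[L] N) := by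
  let e := equivShrink.{w} N
  let : L.Structure (Shrink.{w} N) := e.inducedStructure
  let g : N ≃[L] Shrink.{w} N := e.inducedStructureEquiv
  obtain ⟨f⟩ := h (Shrink.{w} N) e.symm.injective.countable
    (hN.trans (StrongHomClass.elementarilyEquivalent g))
  exact ⟨g.symm.comp f⟩

theorem exists_countable_elementarySubstructure [Countable L.Symbols] {s : Set M}
    (hs : s.Countable) : ∃ S : L.ElementarySubstructure M, s ⊆ S ∧ Countable S := by
  cases finite_or_infinite M
  · exact ⟨⊤, fun _ _ => trivial, inferInstance⟩
  · have hL : L.card ≤ Cardinal.aleph0 := Cardinal.mk_le_aleph0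
    obtain ⟨S, hsS, hS⟩ := exists_elementarySubstructure_card_eq L s Cardinal.aleph0.{w} le_rfl
      (by simpa using hs) (by simpa using hL) (by simp)
    refine ⟨S, hsS, Cardinal.mk_le_aleph0_iff.1 ?_⟩
    simpa using hS.le

/-- A structure determined by its theory, in a countable language, is saturated over the empty set:
a family of definable sets with the finite intersection property has a common element. Compactness
and the downward Löwenheim--Skolem theorem give such an element in a countable elementarily
equivalent structure, which is isomorphic to `M`. -/
theorem DeterminedByTheory.sInter_nonempty [Countable L.Symbols] [Nonempty M]
    (h : DeterminedByTheory L M) {α : Type*} [Countable α] (𝒮 : Set (Set (α → M)))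
    (hdef : ∀ s ∈ 𝒮, (∅ : Set M).Definable L s)
    (hfin : ∀ t ⊆ 𝒮, t.Finite → (⋂₀ t).Nonempty) : (⋂₀ 𝒮).Nonempty := by
  classical
  let T : L[[α]].Theory := {σ | Set.ofPred (Formula.equivSentence.symm σ).Realize ∈ 𝒮} ∪
    (L.lhomWithConstants α).onTheory (L.completeTheory M)
  have hT : T.IsSatisfiable := by
    rw [Theory.isSatisfiable_iff_isFinitelySatisfiable]
    intro T0 hT0
    obtain ⟨x, hx⟩ := hfin ({s | ∃ σ ∈ T0, s = Set.ofPred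
        (Formula.equivSentence.symm σ).Realize} ∩ 𝒮) inter_subset_right
      (((T0.finite_toSet.image fun σ => Set.ofPred
        ((Formula.equivSentence (α := α)).symm σ).Realize).subset (by
          rintro _ ⟨σ, hσ, rfl⟩
          exact ⟨σ, hσ, rfl⟩)).inter_of_left _)
    let := constantsOn.structure x
    have : M ⊨ (L.lhomWithConstants α).onTheory (L.completeTheory M) :=
      (LHom.onTheory_model _ _).2 ⟨fun _ hφ => hφ⟩
    have : M ⊨ (T0 : L[[α]].Theory) := by
      refine ⟨fun σ hσ => ?_⟩
      rcases hT0 hσ with h' | h'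
      · exact (Formula.realize_equivSentence_symm_con M σ).1 (hx _ ⟨⟨σ, hσ, rfl⟩, h'⟩)
      · exact Theory.realize_sentence_of_mem _ h'
    exact Theory.Model.isSatisfiable M
  obtain ⟨N⟩ := hT
  let := (L.lhomWithConstants α).reduct N
  have := (L.lhomWithConstants α).isExpansionOn_reduct N
  have hNM : M ≅[L] N := by
    have : N ⊨ (L.lhomWithConstants α).onTheory (L.completeTheory M) :=
      Theory.Model.mono N.is_model subset_union_right
    have : N ⊨ L.completeTheory M := (LHom.onTheory_model _ _).1 this
    have : M ⊨ L.completeTheory M := ⟨fun _ hφ => hφ⟩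
    exact (completeTheory.isComplete L M).models_elementarily_equivalent M N
  obtain ⟨S, hS, hScount⟩ := exists_countable_elementarySubstructure (L := L)
    (countable_range fun a : α => (L.con a : N))
  obtain ⟨g⟩ := h.nonempty_equiv (hNM.trans S.elementarilyEquivalent.symm)
  let w : α → S := fun a => ⟨(L.con a : N), hS (mem_range_self a)⟩
  refine ⟨g.symm ∘ w, fun s hs => ?_⟩
  obtain ⟨φ, rfl⟩ := empty_definable_iff.1 (hdef s hs)
  change φ.Realize (g.symm ∘ w)
  rw [StrongHomClass.realize_formula g.symm φ, ← S.subtype.map_formula φ w]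
  have hφ : N ⊨ Formula.equivSentence φ := by
    refine Theory.realize_sentence_of_mem T (Or.inl ?_)
    simpa using hs
  exact (Formula.realize_equivSentence N φ).1 hφ

/-! ### Definable sets of sequences -/

theorem FirstOrder.Language.Formula.realize_congr_freeVar {α : Type*} [DecidableEq α]
    (φ : L.Formula α) {x y : α → M} (h : ∀ a ∈ φ.freeVarFinset, x a = y a) :
    φ.Realize x ↔ φ.Realize y := by
  unfold Formula.Realize
  rw [← BoundedFormula.realize_restrictFreeVar (φ := φ) (f := id)
      (v := fun a : φ.freeVarFinset => x a) x (fun _ => rfl),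
    BoundedFormula.realize_restrictFreeVar (φ := φ) (f := id) y (fun a => h a a.2)]

/-- A definable set depends on finitely many coordinates only. -/
theorem Set.Definable.exists_finset {α : Type*} {D : Set (α → M)}
    (hD : (∅ : Set M).Definable L D) :
    ∃ F : Finset α, ∀ x y : α → M, (∀ a ∈ F, x a = y a) → (x ∈ D ↔ y ∈ D) := by
  classical
  obtain ⟨φ, rfl⟩ := empty_definable_iff.1 hD
  exact ⟨φ.freeVarFinset, fun x y h => φ.realize_congr_freeVar h⟩

/-- `Set.Definable.image_comp` without finiteness of the set `β` of variables: a formula involves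
only finitely many of them. -/
theorem Set.Definable.image_comp_of_finite [Nonempty M] {α β : Type*} [Finite α]
    {D : Set (β → M)} (hD : (∅ : Set M).Definable L D) (k : α → β) :
    (∅ : Set M).Definable L ((fun x : β → M => x ∘ k) '' D) := by
  classical
  obtain ⟨φ, rfl⟩ := empty_definable_iff.1 hD
  cases nonempty_fintype α
  let F : Finset β := φ.freeVarFinset ∪ Finset.univ.image k
  let ψ : L.Formula F :=
    φ.restrictFreeVar fun b => ⟨b.1, Finset.mem_union_left _ b.2⟩
  have hψ (x : β → M) : ψ.Realize (fun b => x b) ↔ φ.Realize x :=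
    BoundedFormula.realize_restrictFreeVar x fun _ => rfl
  let k' : α → F := fun a => ⟨k a, Finset.mem_union_right _ (by simp)⟩
  have := Definable.image_comp (A := (∅ : Set M)) (s := Set.ofPred ψ.Realize)
    (empty_definable_iff.2 ⟨ψ, rfl⟩) k'
  convert this using 1
  ext y
  constructor
  · rintro ⟨x, hx, rfl⟩
    exact ⟨fun b => x b, (hψ x).2 hx, rfl⟩
  · rintro ⟨x, hx, rfl⟩
    let x' : β → M := fun b => if h : b ∈ F then x ⟨b, h⟩ else Classical.arbitrary M
    have hx' : (fun b : F => x' b) = x := by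
      ext b
      simp [x']
    refine ⟨x', (hψ x').1 (hx'.symm ▸ hx), ?_⟩
    ext a
    exact congrFun hx' (k' a)

/-! ### Types and omitting a nonisolated type -/

/-- Two tuples have the same complete type over the empty set, expressed through the definable sets
that contain them. -/
def SameType (L : FirstOrder.Language.{u, v}) {M : Type w} [L.Structure M] {α : Type*}
    (x y : α → M) : Prop :=
  ∀ D : Set (α → M), (∅ : Set M).Definable L D → (x ∈ D ↔ y ∈ D)

theorem SameType.of_equiv {α : Type*} (x : α → M) (g : M ≃[L] M) : SameType L x (g ∘ x) := by
  intro D hD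
  obtain ⟨φ, rfl⟩ := empty_definable_iff.1 hD
  exact (StrongHomClass.realize_formula g φ).symm

/-- Only finitely many complete types over the empty set are realized by `α`-tuples of `M`. -/
def FinitelyManyTypes (L : FirstOrder.Language.{u, v}) (M : Type w) [L.Structure M]
    (α : Type*) : Prop :=
  ∃ S : Set (α → M), S.Finite ∧ ∀ x : α → M, ∃ s ∈ S, SameType L s x

theorem AlmostTransitive.finitelyManyTypes {r : ℕ} (h : AlmostTransitive L M r) :
    FinitelyManyTypes L M (Fin r) := by
  obtain ⟨S, hS, hx⟩ := h
  refine ⟨S, hS, fun x => ?_⟩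
  obtain ⟨s, hs, g, hg⟩ := hx x
  obtain rfl : g ∘ s = x := funext hg
  exact ⟨s, hs, SameType.of_equiv s g⟩

/-- The complete type of `m` is not isolated: no definable set containing `m` consists of tuples of
the same type only. -/
def Nonisolated (L : FirstOrder.Language.{u, v}) {M : Type w} [L.Structure M] {α : Type*}
    (m : α → M) : Prop :=
  ∀ D : Set (α → M), (∅ : Set M).Definable L D → m ∈ D → ∃ x ∈ D, ¬ SameType L m x

/-- The forcing conditions for a generic sequence in `M`: nonempty definable sets of sequences, the
smaller sets being the stronger, hence larger, conditions. -/
abbrev DefinableCondition (L : FirstOrder.Language.{u, v}) (M : Type w) [L.Structure M] :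
    Type w :=
  {E : Set (ℕ → M) // E.Nonempty ∧ (∅ : Set M).Definable L E}ᵒᵈ

/-- The conditions that decide `∃ x, χ(v, x)` for a generic sequence `v`, and in the positive case
name an entry of `v` as a witness. They ensure that the range of `v` passes the
Tarski--Vaught test. -/
def witnessConditions (χ : L.Formula (ℕ ⊕ Fin 1)) : Order.Cofinal (DefinableCondition L M) where
  carrier := {E | (∀ v ∈ (OrderDual.ofDual E).1, ∀ a : Fin 1 → M, ¬ χ.Realize (Sum.elim v a)) ∨
    ∃ j : ℕ, ∀ v ∈ (OrderDual.ofDual E).1, χ.Realize (Sum.elim v fun _ => v j)}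
  isCofinal := by
    classical
    rintro ⟨E, hE, hEdef⟩
    by_cases h : ∃ v ∈ E, ∃ a : Fin 1 → M, χ.Realize (Sum.elim v a)
    · obtain ⟨v, hv, a, ha⟩ := h
      obtain ⟨F, hF⟩ := hEdef.exists_finset
      -- A coordinate `j` on which neither `E` nor `χ` depends can be given the value of the
      -- witness.
      obtain ⟨j, hj⟩ := Infinite.exists_notMem_finset (F ∪ χ.freeVarFinset.toLeft)
      rw [Finset.mem_union, not_or] at hj
      refine ⟨OrderDual.toDual ⟨E ∩ {v | χ.Realize (Sum.elim v fun _ => v j)}, ?_, ?_⟩,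
        Or.inr ⟨j, fun v hv => hv.2⟩, fun _ hv => hv.1⟩
      · refine ⟨Function.update v j (a 0), ?_, ?_⟩
        · refine (hF _ _ fun b hb => ?_).1 hv
          rw [Function.update_of_ne]
          rintro rfl
          exact hj.1 hb
        · refine (χ.realize_congr_freeVar ?_).1 ha
          rintro (b | b) hb
          · have : b ≠ j := by
              rintro rfl
              exact hj.2 (by simpa using hb)
            simp [Function.update_of_ne this]
          · simp [Subsingleton.elim b 0]
      · refine hEdef.inter (empty_definable_iff.2
          ⟨χ.relabel (Sum.elim id fun _ => j), Set.ext fun v => ?_⟩)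
        have : v ∘ Sum.elim id (fun _ : Fin 1 => j) = Sum.elim v fun _ => v j := by
          ext (b | b) <;> rfl
        change _ ↔ Formula.Realize _ _
        rw [Formula.realize_relabel, this]
        rfl
    · push Not at h
      exact ⟨OrderDual.toDual ⟨E, hE, hEdef⟩, Or.inl h, le_rfl⟩

/-- The conditions that prevent the subtuple `v ∘ k` of a generic sequence `v` from having the
nonisolated type of `m`. -/
def omittingConditions [Nonempty M] {α : Type*} [Finite α] {m : α → M} (hm : Nonisolated L m)
    (k : α → ℕ) : Order.Cofinal (DefinableCondition L M) where
  carrier := {E | ∀ v ∈ (OrderDual.ofDual E).1, ¬ SameType L m (v ∘ k)}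
  isCofinal := by
    rintro ⟨E, hE, hEdef⟩
    have himage := hEdef.image_comp_of_finite k
    by_cases hmem : m ∈ (fun v : ℕ → M => v ∘ k) '' E
    · obtain ⟨_, ⟨v, hv, rfl⟩, hne⟩ := hm _ himage hmem
      simp only [SameType, not_forall] at hne
      obtain ⟨D, hD, hne⟩ := hne
      -- Either `D` or its complement, whichever excludes `m`.
      let D' : Set (α → M) := {y | ¬ (m ∈ D ↔ y ∈ D)}
      have hD' : (∅ : Set M).Definable L D' := by
        by_cases h : m ∈ D
        · convert hD.compl using 1
          ext y
          simp [D', h]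
        · convert hD using 1
          ext y
          simp [D', h]
      exact ⟨OrderDual.toDual ⟨E ∩ {v | v ∘ k ∈ D'}, ⟨v, hv, hne⟩,
        hEdef.inter (hD'.preimage_comp k)⟩, fun v hv hs => hv.2 (hs D hD), fun _ hv => hv.1⟩
    · exact ⟨OrderDual.toDual ⟨E, hE, hEdef⟩,
        fun v hv hs => hmem ((hs _ himage).2 (mem_image_of_mem _ hv)), le_rfl⟩

/-- An instance of the omitting types theorem: a nonisolated type would be omitted in a countable
elementary substructure of `M`, consisting of the entries of a generic sequence. By saturation a
generic sequence exists in `M` itself. -/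
theorem DeterminedByTheory.not_nonisolated [Countable L.Symbols] [Nonempty M]
    (h : DeterminedByTheory L M) {α : Type*} [Finite α] (m : α → M) : ¬ Nonisolated L m := by
  classical
  intro hm
  have : Encodable (L.Formula (ℕ ⊕ Fin 1) ⊕ (α → ℕ)) := Encodable.ofCountable _
  let 𝒟 : L.Formula (ℕ ⊕ Fin 1) ⊕ (α → ℕ) → Order.Cofinal (DefinableCondition L M) :=
    Sum.elim witnessConditions (omittingConditions hm)
  let p : DefinableCondition L M := OrderDual.toDual ⟨univ, univ_nonempty, definable_univ⟩
  let G := Order.idealOfCofinals p 𝒟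
  obtain ⟨v, hv⟩ := h.sInter_nonempty {E | ∃ e ∈ G, E = (OrderDual.ofDual e).1}
    (by
      rintro _ ⟨e, -, rfl⟩
      exact (OrderDual.ofDual e).2.2)
    (by
      intro t ht htfin
      have : ∃ e ∈ G, ∀ E ∈ t, (OrderDual.ofDual e).1 ⊆ E := by
        induction t, htfin using Set.Finite.induction_on with
        | empty => exact ⟨p, Order.mem_idealOfCofinals p 𝒟, by simp⟩
        | @insert E t _ _ ih =>
          obtain ⟨e₁, he₁, rfl⟩ := ht (mem_insert _ _)
          obtain ⟨e₂, he₂, h₂⟩ := ih ((subset_insert _ _).trans ht)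
          obtain ⟨e, he, h₁e, h₂e⟩ := G.directed e₁ he₁ e₂ he₂
          refine ⟨e, he, ?_⟩
          rintro E (rfl | hE)
          · exact h₁e
          · exact Subset.trans h₂e (h₂ E hE)
      obtain ⟨e, -, he⟩ := this
      obtain ⟨x, hx⟩ := (OrderDual.ofDual e).2.1
      exact ⟨x, fun E hE => he E hE hx⟩)
  -- The parameters of a definable set are entries of `v`, so they can be replaced by variables.
  have hmeets : L.MeetsDefinable (range v) := by
    rintro D ⟨d, hd⟩ hD
    obtain ⟨φ, hφ⟩ := definable_iff_exists_formula_sum.1 hD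
    choose k hk using fun a : range v => a.2
    have hreal (a : Fin 1 → M) :
        (φ.relabel (Sum.map k id)).Realize (Sum.elim v a) ↔ a 0 ∈ D := by
      have h₁ : Sum.elim v a ∘ Sum.map k id = Sum.elim (fun b : range v => (b : M)) a := by
        ext (b | b)
        · exact hk b
        · rfl
      rw [Formula.realize_relabel, h₁]
      exact (Set.ext_iff.1 hφ a).symm
    obtain ⟨e, he, heG⟩ := Order.cofinal_meets_idealOfCofinals p 𝒟
      (Sum.inl (φ.relabel (Sum.map k id)))
    have hve : v ∈ (OrderDual.ofDual e).1 := hv _ ⟨e, heG, rfl⟩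
    rcases he with he | ⟨j, he⟩
    · exact absurd ((hreal fun _ => d).2 hd) (he v hve _)
    · exact ⟨v j, (hreal _).1 (he v hve), mem_range_self j⟩
  let S := hmeets.toElementarySubstructure
  have hS : (S : Set M) = range v := hmeets.closure_eq_self
  have : Countable S := by
    have : (S : Set M).Countable := hS ▸ countable_range v
    exact this.to_subtype
  obtain ⟨g⟩ := h.nonempty_equiv S.elementarilyEquivalent.symm
  have hmem (a : α) : (g (m a) : M) ∈ range v := hS ▸ (g (m a)).2
  choose k hk using hmem
  obtain ⟨e, he, heG⟩ := Order.cofinal_meets_idealOfCofinals p 𝒟 (Sum.inr k)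
  refine he v (hv _ ⟨e, heG, rfl⟩) fun D hD => ?_
  obtain ⟨φ, rfl⟩ := empty_definable_iff.1 hD
  have hvk : v ∘ k = S.subtype ∘ g ∘ m := funext hk
  change φ.Realize m ↔ φ.Realize (v ∘ k)
  rw [hvk, S.subtype.map_formula, StrongHomClass.realize_formula g φ]

/-- The part of the Ryll-Nardzewski theorem that is needed: since all types are isolated, finitely
many of the isolating sets cover `α → M` by saturation. -/
theorem DeterminedByTheory.finitelyManyTypes [Countable L.Symbols] [Nonempty M]
    (h : DeterminedByTheory L M) (α : Type*) [Finite α] : FinitelyManyTypes L M α := by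
  -- The nonempty definable sets that isolate a complete type.
  let 𝒞 : Set (Set (α → M)) := {D | (∅ : Set M).Definable L D ∧ D.Nonempty ∧
    ∀ x ∈ D, ∀ y ∈ D, SameType L x y}
  by_cases hfin : ∃ t ⊆ 𝒞, t.Finite ∧ ⋃₀ t = univ
  · obtain ⟨t, ht𝒞, ht, hcover⟩ := hfin
    choose! f hf using fun D (hD : D ∈ 𝒞) => hD.2.1
    refine ⟨f '' t, ht.image f, fun x => ?_⟩
    obtain ⟨D, hD, hx⟩ : x ∈ ⋃₀ t := hcover ▸ mem_univ x
    exact ⟨f D, mem_image_of_mem f hD, (ht𝒞 hD).2.2 _ (hf D (ht𝒞 hD)) _ hx⟩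
  · exfalso
    push Not at hfin
    obtain ⟨m, hm⟩ := h.sInter_nonempty (compl '' 𝒞)
      (by
        rintro _ ⟨D, hD, rfl⟩
        exact hD.1.compl)
      (by
        intro t ht htfin
        rw [← compl_compl (⋂₀ t), compl_sInter, nonempty_compl]
        refine hfin _ ?_ (htfin.image compl)
        rintro _ ⟨_, hD, rfl⟩
        obtain ⟨D, hD, rfl⟩ := ht hD
        rwa [compl_compl])
    refine h.not_nonisolated m fun D hD hmD => ?_
    by_contra! hcon
    -- A definable `D` containing `m` whose elements all have the type of `m` belongs to `𝒞`, but
    -- `m` lies in no member of `𝒞`.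
    refine hm Dᶜ ⟨D, ⟨hD, ⟨m, hmD⟩, fun x hx y hy => ?_⟩, rfl⟩ hmD
    exact fun E hE => (hcon x hx E hE).symm.trans (hcon y hy E hE)

theorem IsOmegaCategorical.finitelyManyTypes [Nonempty M] (h : IsOmegaCategorical L M) (r : ℕ) :
    FinitelyManyTypes L M (Fin r) := by
  rcases h with ⟨hL, h⟩ | h
  · exact h.finitelyManyTypes (Fin r)
  · exact (h r).finitelyManyTypes

end OmegaCategoricity

section BooleanRings

open FirstOrder FirstOrder.Language Set

/-! ### Stone spaces -/

section StoneSpace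

variable {R : Type w} [NonUnitalRing R]

theorem zmod_two_eq_one_iff {z : ZMod 2} : z = 1 ↔ z ≠ 0 := by
  revert z; decide

namespace StoneSpace

theorem mem_stoneSet {φ : StoneSpace R} {a : R} : φ ∈ stoneSet a ↔ φ.1 a = 1 := Iff.rfl

theorem stoneSet_mul (a b : R) : stoneSet (a * b) = stoneSet a ∩ stoneSet b := by
  ext φ
  simp only [mem_inter_iff, mem_stoneSet, map_mul, zmod_two_eq_one_iff, mul_ne_zero_iff]

theorem isTopologicalBasis_stoneSet :
    TopologicalSpace.IsTopologicalBasis (range (stoneSet (R := R))) where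
  exists_subset_inter := by
    rintro _ ⟨a, rfl⟩ _ ⟨b, rfl⟩ φ hφ
    exact ⟨_, ⟨a * b, rfl⟩, by rwa [stoneSet_mul], (stoneSet_mul a b).le⟩
  sUnion_eq := by
    refine eq_univ_of_forall fun φ => ?_
    obtain ⟨a, ha⟩ : ∃ a, φ.1 a ≠ 0 := by
      by_contra! h
      exact φ.2 (NonUnitalRingHom.ext h)
    exact ⟨_, ⟨a, rfl⟩, zmod_two_eq_one_iff.2 ha⟩
  eq_generateFrom := rfl

theorem isOpen_stoneSet (a : R) : IsOpen (stoneSet a) :=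
  isTopologicalBasis_stoneSet.isOpen ⟨a, rfl⟩

theorem exists_mem_stoneSet_notMem {φ ψ : StoneSpace R} (h : φ ≠ ψ) :
    ∃ a, φ ∈ stoneSet a ∧ ψ ∉ stoneSet a := by
  have hne : ∃ a, φ.1 a ≠ ψ.1 a := by
    by_contra! h'
    exact h (Subtype.ext (NonUnitalRingHom.ext h'))
  obtain ⟨a, ha⟩ := hne
  by_cases h1 : φ.1 a = 1
  · exact ⟨a, h1, fun h2 => ha (h1.trans h2.symm)⟩
  · obtain ⟨b, hb⟩ : ∃ b, φ.1 b ≠ 0 := by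
      by_contra! h'
      exact φ.2 (NonUnitalRingHom.ext h')
    have h0 : φ.1 a = 0 := by
      by_contra h'
      exact h1 (zmod_two_eq_one_iff.2 h')
    have h2 : ψ.1 a = 1 := zmod_two_eq_one_iff.2 fun h' => ha (h0.trans h'.symm)
    -- `b + a * b` stands for the difference of `stoneSet b` and `stoneSet a`.
    refine ⟨b + a * b, ?_, ?_⟩
    · simp [mem_stoneSet, h0, zmod_two_eq_one_iff.2 hb]
    · have (z : ZMod 2) : z + z ≠ 1 := by revert z; decide
      simpa [mem_stoneSet, h2] using this _

theorem mem_stoneIdeal {C : Set (StoneSpace R)} {a : R} :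
    a ∈ stoneIdeal C ↔ ∀ φ ∈ C, φ ∉ stoneSet a := by
  simp only [stoneIdeal, mem_ofPred_eq, eq_empty_iff_forall_notMem, mem_inter_iff, not_and']

theorem mem_closure_iff_stoneIdeal {C : Set (StoneSpace R)} {φ : StoneSpace R} :
    φ ∈ closure C ↔ ∀ a ∈ stoneIdeal C, φ ∉ stoneSet a := by
  rw [isTopologicalBasis_stoneSet.mem_closure_iff]
  simp only [forall_mem_range, mem_stoneIdeal]
  refine forall_congr' fun a => ?_
  rw [← not_imp_not, not_nonempty_iff_eq_empty, eq_empty_iff_forall_notMem]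
  simp only [mem_inter_iff, not_and']

/-- Closed sets correspond injectively to their ideals. -/
theorem eq_of_stoneIdeal_eq {C D : Set (StoneSpace R)} (hC : IsClosed C) (hD : IsClosed D)
    (h : stoneIdeal C = stoneIdeal D) : C = D := by
  rw [← hC.closure_eq, ← hD.closure_eq]
  ext φ
  rw [mem_closure_iff_stoneIdeal, mem_closure_iff_stoneIdeal, h]

theorem exists_stoneSet_eq_biUnion {ι : Type*} (s : Finset ι) (a : ι → R) :
    ∃ b, stoneSet b = ⋃ i ∈ s, stoneSet (a i) := by
  classical
  induction s using Finset.induction_on with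
  | empty =>
    refine ⟨0, eq_empty_iff_forall_notMem.2 (fun φ => ?_) |>.trans (by simp)⟩
    simp [mem_stoneSet]
  | insert i s _ ih =>
    obtain ⟨b, hb⟩ := ih
    refine ⟨a i + b + a i * b, ?_⟩
    rw [Finset.set_biUnion_insert, ← hb]
    ext φ
    have (x y : ZMod 2) : x + y + x * y = 1 ↔ x = 1 ∨ y = 1 := by revert x y; decide
    simp [mem_stoneSet, this]

/-- An isolated point of `A` is also isolated in the closure of `A`, because the Stone space is
Hausdorff. -/
theorem exists_stoneSet_inter_closure {A : Set (StoneSpace R)} {φ : StoneSpace R}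
    (hφ : φ ∈ isolatedPoints A) : ∃ a, stoneSet a ∩ closure A = {φ} := by
  obtain ⟨hA, hacc⟩ := hφ
  rw [mem_derivedSet, accPt_iff_nhds] at hacc
  push Not at hacc
  obtain ⟨U, hU, hUA⟩ := hacc
  obtain ⟨_, ⟨a, rfl⟩, ha, haU⟩ := isTopologicalBasis_stoneSet.mem_nhds_iff.1 hU
  refine ⟨a, Subset.antisymm ?_ (singleton_subset_iff.2 ⟨ha, subset_closure hA⟩)⟩
  rintro ψ ⟨hψa, hψ⟩
  by_contra hne
  obtain ⟨c, hψc, hφc⟩ := exists_mem_stoneSet_notMem hne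
  obtain ⟨θ, ⟨hθa, hθc⟩, hθA⟩ := mem_closure_iff.1 hψ _
    ((isOpen_stoneSet a).inter (isOpen_stoneSet c)) ⟨hψa, hψc⟩
  exact hφc (hUA θ ⟨haU hθa, hθA⟩ ▸ hθc)

end StoneSpace

/-- The elements `b` such that, modulo the ideal `I`, there are `n` pairwise disjoint elements none
of which is disjoint from `b`. For `I = stoneIdeal C` this says that `stoneSet b ∩ C` has at
least `n` points. -/
def elementsOfRankAtLeast (I : Set R) (n : ℕ) : Set R :=
  {b | ∃ c : Fin n → R, (∀ i, c i * b ∉ I) ∧ ∀ i j, i ≠ j → c i * c j ∈ I}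

open StoneSpace in
theorem mem_elementsOfRankAtLeast {C : Set (StoneSpace R)} {n : ℕ} {b : R}
    {φ : Fin n → StoneSpace R} (hinj : Function.Injective φ) (hC : ∀ i, φ i ∈ C)
    (hb : ∀ i, φ i ∈ stoneSet b) {a : Fin n → R} (ha : ∀ i, stoneSet (a i) ∩ C = {φ i}) :
    b ∈ elementsOfRankAtLeast (stoneIdeal C) n := by
  have hmem (i : Fin n) : φ i ∈ stoneSet (a i) := by
    have : φ i ∈ stoneSet (a i) ∩ C := ha i ▸ rfl
    exact this.1
  refine ⟨a, fun i h => ?_, fun i j hij => ?_⟩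
  · refine mem_stoneIdeal.1 h _ (hC i) ?_
    rw [stoneSet_mul]
    exact ⟨hmem i, hb i⟩
  · refine mem_stoneIdeal.2 fun ψ hψ h => hij (hinj ?_)
    rw [stoneSet_mul] at h
    have h1 : ψ ∈ ({φ i} : Set _) := ha i ▸ ⟨h.1, hψ⟩
    have h2 : ψ ∈ ({φ j} : Set _) := ha j ▸ ⟨h.2, hψ⟩
    exact h1.symm.trans h2

open StoneSpace in
theorem exists_injective_of_mem_elementsOfRankAtLeast {C : Set (StoneSpace R)} {n : ℕ} {b : R}
    (h : b ∈ elementsOfRankAtLeast (stoneIdeal C) n) :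
    ∃ φ : Fin n → StoneSpace R, Function.Injective φ ∧ ∀ i, φ i ∈ stoneSet b ∩ C := by
  obtain ⟨c, hcb, hc⟩ := h
  have (i : Fin n) : ∃ φ ∈ C, φ ∈ stoneSet (c i * b) := by
    simpa only [mem_stoneIdeal, not_forall, not_not, exists_prop] using hcb i
  choose φ hφC hφ using this
  simp only [stoneSet_mul] at hφ
  refine ⟨φ, fun i j hij => ?_, fun i => ⟨(hφ i).2, hφC i⟩⟩
  by_contra hne
  refine mem_stoneIdeal.1 (hc i j hne) _ (hφC i) ?_
  rw [stoneSet_mul]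
  exact ⟨(hφ i).1, hij ▸ (hφ j).1⟩

end StoneSpace

/-! ### Definability in rings with distinguished ideals -/

section Definability

variable {R : Type w} [NonUnitalRing R] {ι : Type u} (J : ι → Set R)

theorem definable_mem_ideal (i : ι) {α : Type*} (a : α) :
    letI := idealSystem R J
    (∅ : Set R).Definable (idealLanguage ι) {x : α → R | x a ∈ J i} := by
  let := idealSystem R J
  refine empty_definable_iff.2 ⟨Relations.formula (L := idealLanguage ι) (IdealRel.mem i)
    (fun _ : Fin 1 => Term.var a), Set.ext fun x => ?_⟩
  exact Iff.rfl

theorem definable_mul_mem_ideal (i : ι) {α : Type*} (a b : α) :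
    letI := idealSystem R J
    (∅ : Set R).Definable (idealLanguage ι) {x : α → R | x a * x b ∈ J i} := by
  let := idealSystem R J
  refine empty_definable_iff.2 ⟨Relations.formula (L := idealLanguage ι) (IdealRel.mem i)
    (fun _ : Fin 1 => Term.func (L := idealLanguage ι) BoolRingFunc.mul
      ![Term.var a, Term.var b]), Set.ext fun x => ?_⟩
  exact Iff.rfl

theorem definable_elementsOfRankAtLeast (i : ι) (n : ℕ) :
    letI := idealSystem R J
    (∅ : Set R).Definable (idealLanguage ι)
      {x : Fin 1 → R | x 0 ∈ elementsOfRankAtLeast (J i) n} := by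
  let := idealSystem R J
  have h₁ := definable_biInter_finset (fun k : Fin n =>
    (definable_mul_mem_ideal J i (Sum.inr k : Fin 1 ⊕ Fin n) (Sum.inl 0)).compl) Finset.univ
  have h₂ := definable_biInter_finset (fun p : Fin n × Fin n =>
    definable_mul_mem_ideal J i (Sum.inr p.1 : Fin 1 ⊕ Fin n) (Sum.inr p.2))
    (Finset.univ.filter fun p => p.1 ≠ p.2)
  convert (h₁.inter h₂).image_comp (Sum.inl : Fin 1 → Fin 1 ⊕ Fin n) using 1
  ext x
  constructor
  · rintro ⟨c, hcb, hc⟩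
    exact ⟨Sum.elim x c, ⟨by simpa using hcb, by simpa using hc⟩, rfl⟩
  · rintro ⟨y, ⟨h, h'⟩, rfl⟩
    exact ⟨y ∘ Sum.inr, by simpa using h, by simpa using h'⟩

end Definability

/-! ### Finiteness of closure subalgebras and of isolated points -/

/-- The members of `𝒞` that do not separate points lying in the same closed members of `𝒞` form a
closure subalgebra `𝒟`. It contains the closed members, so it is all of `𝒞`. -/
theorem finite_of_finite_closed_mem {X : Type w} [TopologicalSpace X] (𝒞 : ClosureSubalgebra X)
    (hgen : 𝒞.GeneratedByClosed) (hfin : {C ∈ 𝒞.toBooleanSubalgebra | IsClosed C}.Finite) :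
    Finite 𝒞.toBooleanSubalgebra := by
  let 𝒦 : Set (Set X) := {C ∈ 𝒞.toBooleanSubalgebra | IsClosed C}
  have : Finite 𝒦 := hfin
  -- Two points lie in the same cell of the partition induced by `𝒦` when `t` agrees on them.
  let t : X → Set 𝒦 := fun x => {C | x ∈ C.1}
  let 𝒟 : ClosureSubalgebra X :=
    { carrier := {A | A ∈ 𝒞.toBooleanSubalgebra ∧ ∀ x y, t x = t y → x ∈ A → y ∈ A}
      supClosed' := by
        rintro A ⟨hA, hA'⟩ B ⟨hB, hB'⟩
        exact ⟨BooleanSubalgebra.sup_mem hA hB,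
          fun x y h => Or.imp (hA' x y h) (hB' x y h)⟩
      infClosed' := by
        rintro A ⟨hA, hA'⟩ B ⟨hB, hB'⟩
        exact ⟨BooleanSubalgebra.inf_mem hA hB,
          fun x y h => And.imp (hA' x y h) (hB' x y h)⟩
      compl_mem' := by
        rintro A ⟨hA, hA'⟩
        exact ⟨BooleanSubalgebra.compl_mem hA, fun x y h hx hy => hx (hA' y x h.symm hy)⟩
      bot_mem' := ⟨BooleanSubalgebra.bot_mem, fun _ _ _ h => h⟩
      closure_mem' := by
        rintro A ⟨hA, -⟩
        have hcl : closure A ∈ 𝒞.toBooleanSubalgebra := 𝒞.closure_mem' A hA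
        exact ⟨hcl, fun x y h hx =>
          (Set.ext_iff.1 h ⟨closure A, hcl, isClosed_closure⟩).1 hx⟩ }
  have hle : 𝒞.toBooleanSubalgebra ≤ 𝒟.toBooleanSubalgebra := hgen 𝒟 fun C hC hcl =>
    ⟨hC, fun x y h hx => (Set.ext_iff.1 h ⟨C, hC, hcl⟩).1 hx⟩
  refine Finite.of_injective (fun A : 𝒞.toBooleanSubalgebra => t '' (A : Set X)) ?_
  have key (A B : 𝒞.toBooleanSubalgebra) (h : t '' (A : Set X) ⊆ t '' (B : Set X)) :
      (A : Set X) ⊆ B := by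
    intro x hx
    obtain ⟨y, hy, hyx⟩ := h (mem_image_of_mem t hx)
    exact (hle B.2).2 y x hyx hy
  intro A B h
  exact Subtype.ext (Subset.antisymm (key A B h.le) (key B A h.ge))

variable {R : Type w} [NonUnitalRing R]

/-- Otherwise there are elements `b n` whose basic open set meets the closure of `A` in exactly `n`
points; their types are pairwise distinct. -/
theorem finite_isolatedPoints {ι : Type u} (J : ι → Set R)
    (h : letI := idealSystem R J; FinitelyManyTypes (idealLanguage ι) R (Fin 1))
    {A : Set (StoneSpace R)} {i : ι} (hi : J i = stoneIdeal (closure A)) :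
    (isolatedPoints A).Finite := by
  let := idealSystem R J
  by_contra hinf
  let e := Set.Infinite.natEmbedding _ hinf
  choose a ha using fun n => StoneSpace.exists_stoneSet_inter_closure (e n).2
  choose b hb using fun n => StoneSpace.exists_stoneSet_eq_biUnion (Finset.range n) a
  have hbC (n : ℕ) : stoneSet (b n) ∩ closure A =
      (fun k => (e k : StoneSpace R)) '' (Finset.range n) := by
    rw [hb, iUnion₂_inter]
    simp only [ha]
    ext φ
    simp [eq_comm]
  have hinj : Function.Injective fun k => (e k : StoneSpace R) :=
    Subtype.val_injective.comp e.injective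
  have hmem (n : ℕ) : b n ∈ elementsOfRankAtLeast (J i) n := by
    have hφ (k : Fin n) : (e k : StoneSpace R) ∈ stoneSet (b n) ∩ closure A := by
      rw [hbC]
      exact ⟨k, by simp, rfl⟩
    rw [hi]
    exact mem_elementsOfRankAtLeast (hinj.comp Fin.val_injective) (fun k => (hφ k).2)
      (fun k => (hφ k).1) (a := fun k => a k) fun k => ha k
  have hnotMem {m n : ℕ} (hmn : m < n) : b m ∉ elementsOfRankAtLeast (J i) n := by
    rw [hi]
    intro h
    obtain ⟨φ, hφ, hφC⟩ := exists_injective_of_mem_elementsOfRankAtLeast h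
    simp only [hbC] at hφC
    have h1 : (range φ).ncard ≤ m := by
      refine (ncard_le_ncard (range_subset_iff.2 hφC) (toFinite _)).trans ?_
      refine (ncard_image_le (toFinite _)).trans ?_
      rw [ncard_coe_finset, Finset.card_range]
    rw [← image_univ, ncard_image_of_injective _ hφ, ncard_univ, Nat.card_fin] at h1
    omega
  obtain ⟨S, hS, hST⟩ := h
  choose s hs hst using fun n => hST fun _ => b n
  have : Finite S := hS
  obtain ⟨m, n, hne, hmn⟩ := Finite.exists_ne_map_eq_of_infinite fun n => (⟨s n, hs n⟩ : S)
  have hmn : s m = s n := congrArg Subtype.val hmn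
  have hsame (k : ℕ) : b m ∈ elementsOfRankAtLeast (J i) k ↔
      b n ∈ elementsOfRankAtLeast (J i) k :=
    (hst m _ (definable_elementsOfRankAtLeast J i k)).symm.trans
      (hmn ▸ hst n _ (definable_elementsOfRankAtLeast J i k))
  rcases hne.lt_or_gt with hlt | hlt
  · exact hnotMem hlt ((hsame n).2 (hmem n))
  · exact hnotMem hlt ((hsame m).1 (hmem m))

/-- A closed member of `𝒞` is determined by its ideal, and the ideal, being definable, by the
representatives of the finitely many types that it contains. -/
theorem finite_closed_mem (𝒞 : ClosureSubalgebra (StoneSpace R))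
    (h : letI := idealSystem R fun C : 𝒞.toBooleanSubalgebra =>
          stoneIdeal (closure (C : Set (StoneSpace R)))
      FinitelyManyTypes (idealLanguage 𝒞.toBooleanSubalgebra) R (Fin 1)) :
    {C ∈ 𝒞.toBooleanSubalgebra | IsClosed C}.Finite := by
  obtain ⟨S, hS, hST⟩ := h
  refine Set.Finite.of_injOn (f := fun C => {s ∈ S | s 0 ∈ stoneIdeal C})
    (t := 𝒫 S) (fun C _ s hs => hs.1) ?_ hS.finite_subsets
  rintro C ⟨hC, hCcl⟩ D ⟨hD, hDcl⟩ hCD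
  refine StoneSpace.eq_of_stoneIdeal_eq hCcl hDcl (Set.ext fun a => ?_)
  obtain ⟨s, hs, hsa⟩ := hST fun _ => a
  have hsC := hsa _ (definable_mem_ideal _ ⟨C, hC⟩ 0)
  have hsD := hsa _ (definable_mem_ideal _ ⟨D, hD⟩ 0)
  simp only [mem_ofPred_eq, hCcl.closure_eq, hDcl.closure_eq] at hsC hsD
  have := Set.ext_iff.1 hCD s
  simp only [mem_ofPred_eq, hs, true_and] at this
  rw [← hsC, ← hsD, this]

end BooleanRings

theorem proposition3p1 (R : Type*) [NonUnitalRing R] (hR : ∀ a : R, IsIdempotentElem a)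
    [Countable R] (𝒞 : ClosureSubalgebra (StoneSpace R)) (hgen : 𝒞.GeneratedByClosed)
    (hcat : IsOmegaCategoricalSystem R
      (fun C : 𝒞.toBooleanSubalgebra => stoneIdeal (closure (C : Set (StoneSpace R))))) :
    Finite 𝒞.toBooleanSubalgebra ∧
      ∀ A : 𝒞.toBooleanSubalgebra, IsAtom A →
        (isolatedPoints (A : Set (StoneSpace R))).Finite := by
  let J := fun C : 𝒞.toBooleanSubalgebra => stoneIdeal (closure (C : Set (StoneSpace R)))
  let := idealSystem R J
  have : Nonempty R := ⟨0⟩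
  have htypes := IsOmegaCategorical.finitelyManyTypes hcat 1
  exact ⟨finite_of_finite_closed_mem 𝒞 hgen (finite_closed_mem 𝒞 htypes),
    fun A _ => finite_isolatedPoints J htypes (i := A) rfl⟩
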